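/- For real random variables $x,y$ with finite first moments and characteristic functions $f_x,f_y$, joint characteristic function $f_{x,y}$, let $$\mathrm{dCov}^2(x,y)=\int_{\mathbb R^2}\frac{|f_{x,y}(t,s)-f_x(t)f_y(s)|^2}{\pi^2\,|t|^2|s|^2}\,dt\,ds .$$ For random vectors $X=(x_1,\dots,x_p)^T$ and $Y=(y_1,\dots,y_q)^T$ with $p,q\ge 1$ put $$\phi_1^{(p,q)}=\frac{\sum_{i=1}^p\sum_{j=1}^q \mathrm{dCov}^2(x_i,y_j)}{\sqrt{\sum_{i,i'=1}^p \mathrm{dCov}^2(x_i,x_{i'})\,\sum_{j,j'=1}^q \mathrm{dCov}^2(y_j,y_{j'})}},\qquad \phi_2^{(p,q)}=\frac{\sum_{i=1}^p\sum_{j=1}^q \mathrm{cov}^2(x_i,y_j)}{\sqrt{\sum_{i,i'=1}^p \mathrm{cov}^2(x_i,x_{i'})\,\sum_{j,j'=1}^q \mathrm{cov}^2(y_j,y_{j'})}} .$$ Suppose that $$\begin{pmatrix}X\\Y\end{pmatrix}\sim N\!\left(0,\begin{pmatrix}I_p&\Sigma_{XY}\\ \Sigma_{XY}^T&I_q\end{pmatrix}\right),\qquad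 \Sigma_{XY}=\mathrm{cov}(X,Y).$$ Then $0.89^2\,\phi_2^{(p,q)}\le\phi_1^{(p,q)}\le\phi_2^{(p,q)}$ for all $p,q\ge1$. Consequently, for a family of such pairs $(X,Y)$ whose dimensions satisfy $p\wedge q\to\infty$ (along any given regime), if the limits $\phi_1=\lim\phi_1^{(p,q)}$ and $\phi_2=\lim\phi_2^{(p,q)}$ exist, then $$0.89^2\,\phi_2\le\phi_1\le\phi_2 .$$ -/

import Mathlib

open MeasureTheory ProbabilityTheory Filter Topology

noncomputable section

/-- The squared distance covariance of two real random variables: the weighted `L²` distance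
between the joint characteristic function of `(x, y)` and the product of the marginal
characteristic functions, with weight `(c₁ c₁ |t|^{1+1} |s|^{1+1})⁻¹`, where
`c₁ = π^{(1+1)/2} / Γ((1+1)/2) = π`. -/
def dCovSq {Ω : Type*} [MeasurableSpace Ω] (P : Measure Ω) (x y : Ω → ℝ) : ℝ :=
  ∫ z : ℝ × ℝ,
    ‖charFun (P.map fun ω => WithLp.toLp 2 (x ω, y ω)) (WithLp.toLp 2 (z.1, z.2)) -
        charFun (P.map x) z.1 * charFun (P.map y) z.2‖ ^ 2 /
      (Real.pi * Real.pi * |z.1| ^ 2 * |z.2| ^ 2)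

/-- The random vector `(X, Y)` has the law `N(0, [[I_p, S], [Sᵀ, I_q]])`. -/
structure IsStdGaussianPair {Ω : Type*} [MeasurableSpace Ω] (P : Measure Ω) {p q : ℕ}
    (X : Ω → EuclideanSpace ℝ (Fin p)) (Y : Ω → EuclideanSpace ℝ (Fin q))
    (S : Matrix (Fin p) (Fin q) ℝ) : Prop where
  gaussian : HasGaussianLaw (fun ω => (X ω, Y ω)) P
  mean_X : ∀ i, ∫ ω, X ω i ∂P = 0
  mean_Y : ∀ j, ∫ ω, Y ω j ∂P = 0
  cov_X : ∀ i i', cov[fun ω => X ω i, fun ω => X ω i'; P] = (1 : Matrix (Fin p) (Fin p) ℝ) i i'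
  cov_Y : ∀ j j', cov[fun ω => Y ω j, fun ω => Y ω j'; P] = (1 : Matrix (Fin q) (Fin q) ℝ) j j'
  cov_XY : ∀ i j, cov[fun ω => X ω i, fun ω => Y ω j; P] = S i j

/-- The normalized aggregate of marginal squared distance covariances, in fixed dimensions;
its limit is `φ₁`. -/
def signalDCov {Ω : Type*} [MeasurableSpace Ω] (P : Measure Ω) {p q : ℕ}
    (X : Ω → EuclideanSpace ℝ (Fin p)) (Y : Ω → EuclideanSpace ℝ (Fin q)) : ℝ :=
  (∑ i, ∑ j, dCovSq P (fun ω => X ω i) (fun ω => Y ω j)) /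
    √((∑ i, ∑ i', dCovSq P (fun ω => X ω i) (fun ω => X ω i')) *
      (∑ j, ∑ j', dCovSq P (fun ω => Y ω j) (fun ω => Y ω j')))

/-- The normalized aggregate of squared covariances, in fixed dimensions;
its limit is `φ₂`. -/
def signalCov {Ω : Type*} [MeasurableSpace Ω] (P : Measure Ω) {p q : ℕ}
    (X : Ω → EuclideanSpace ℝ (Fin p)) (Y : Ω → EuclideanSpace ℝ (Fin q)) : ℝ :=
  (∑ i, ∑ j, cov[fun ω => X ω i, fun ω => Y ω j; P] ^ 2) /
    √((∑ i, ∑ i', cov[fun ω => X ω i, fun ω => X ω i'; P] ^ 2) *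
      (∑ j, ∑ j', cov[fun ω => Y ω j, fun ω => Y ω j'; P] ^ 2))

end

/-! For a standard normal pair, dCov² depends only on the correlation `r`: it is `g(r) = gaussDCovSq
r`. Reflecting one frequency symmetrizes the integrand, replacing `(e^{-rts} - 1)²` by `coshGap
(rts)`, whose power series has nonnegative coefficients and starts at degree 2. So `g(r)/r²` behaves
as a series in `r²` with nonnegative coefficients, lying between its value `1/π` at 0 and its value
`g(1)` at `|r| = 1`. Gaussian moments and a tail estimate give `π g(1) ≤ 1/0.89²`
(`sum_dCovTerm_le`), hence `0.89² r² g(1) ≤ g(r) ≤ r² g(1)`. With identity diagonal blocks the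
denominators are `g(1)√(pq)` and `√(pq)`, so summing over entries of `S` finishes. -/

/-! ### Power series of the symmetrized kernel -/

/-- The even function `cosh (2u) - 2 cosh u + 1`, half of `(eᵘ - 1)² + (e⁻ᵘ - 1)²`. -/
noncomputable def coshGap (u : ℝ) : ℝ := Real.cosh (2 * u) - 2 * Real.cosh u + 1

/-- The coefficients of the power series of `coshGap u / u²` in `u²`. -/
noncomputable def coshGapCoeff (m : ℕ) : ℝ := (4 ^ (m + 1) - 2) / (2 * (m + 1)).factorial

lemma coshGapCoeff_nonneg (m : ℕ) : 0 ≤ coshGapCoeff m := by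
  unfold coshGapCoeff
  have : (1 : ℝ) ≤ 4 ^ m := one_le_pow₀ (by norm_num)
  have : (2 : ℝ) ≤ 4 ^ (m + 1) := by rw [pow_succ]; linarith
  exact div_nonneg (by linarith) (by positivity)

lemma hasSum_coshGap (u : ℝ) :
    HasSum (fun m : ℕ => coshGapCoeff m * u ^ (2 * (m + 1))) (coshGap u) := by
  have h := (Real.hasSum_cosh (2 * u)).sub ((Real.hasSum_cosh u).mul_left 2)
  -- The degree-0 coefficient `1 - 2` cancels the `+ 1` in `coshGap`, so the series starts at `u²`.
  rw [← hasSum_nat_add_iff' 1] at h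
  have h0 : coshGap u = Real.cosh (2 * u) - 2 * Real.cosh u - ∑ i ∈ Finset.range 1,
      ((2 * u) ^ (2 * i) / (2 * i).factorial - 2 * (u ^ (2 * i) / (2 * i).factorial)) := by
    simp only [coshGap, Finset.sum_range_one, mul_zero, pow_zero, Nat.factorial_zero, Nat.cast_one]
    ring
  rw [h0]
  refine h.congr_fun fun m => ?_
  rw [mul_pow, pow_mul (2 : ℝ), coshGapCoeff, show (2 : ℝ) ^ 2 = 4 by norm_num]
  ring

lemma sq_le_coshGap (u : ℝ) : u ^ 2 ≤ coshGap u := by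
  have h := le_hasSum (hasSum_coshGap u) 0 fun m _ =>
    mul_nonneg (coshGapCoeff_nonneg m) ((even_two_mul _).pow_nonneg u)
  norm_num [coshGapCoeff] at h
  exact h

lemma coshGap_nonneg (u : ℝ) : 0 ≤ coshGap u := (sq_nonneg u).trans (sq_le_coshGap u)

/-- Termwise: each power of `r` is even and at least 2, so it is at most `r²`. -/
lemma coshGap_mul_le {r : ℝ} (hr : |r| ≤ 1) (u : ℝ) : coshGap (r * u) ≤ r ^ 2 * coshGap u := by
  refine hasSum_le (fun m => ?_) (hasSum_coshGap (r * u)) ((hasSum_coshGap u).mul_left (r ^ 2))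
  have h1 : r ^ (2 * (m + 1)) ≤ r ^ 2 := by
    have h2 : r ^ 2 ≤ 1 := (sq_le_one_iff_abs_le_one r).2 hr
    rw [pow_mul]
    exact pow_le_of_le_one (sq_nonneg r) h2 (Nat.succ_ne_zero m)
  have h3 : 0 ≤ coshGapCoeff m * u ^ (2 * (m + 1)) :=
    mul_nonneg (coshGapCoeff_nonneg m) ((even_two_mul _).pow_nonneg u)
  calc coshGapCoeff m * (r * u) ^ (2 * (m + 1))
      = r ^ (2 * (m + 1)) * (coshGapCoeff m * u ^ (2 * (m + 1))) := by rw [mul_pow]; ring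
    _ ≤ _ := mul_le_mul_of_nonneg_right h1 h3

/-! ### Gaussian moments -/

/-- The product `∏ j < m, (j + 1/2)`: the `2m`-th moment of `e^{-t²}`, normalized by `√π`. -/
noncomputable def gaussMoment : ℕ → ℝ
  | 0 => 1
  | m + 1 => (m + 1 / 2) * gaussMoment m

lemma integrable_pow_mul_exp_neg_sq (n : ℕ) :
    Integrable fun t : ℝ => t ^ n * Real.exp (-t ^ 2) := by
  have := integrable_rpow_mul_exp_neg_mul_sq one_pos
    (show (-1 : ℝ) < n by linarith [(Nat.cast_nonneg n : (0 : ℝ) ≤ n)])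
  simpa [Real.rpow_natCast] using this

lemma integral_pow_mul_exp_neg_sq (m : ℕ) :
    ∫ t : ℝ, t ^ (2 * m) * Real.exp (-t ^ 2) = √Real.pi * gaussMoment m := by
  induction m with
  | zero => simpa [gaussMoment] using integral_gaussian 1
  | succ m ih =>
    -- Integration by parts: this total derivative integrates to zero, which gives the moment
    -- recursion.
    have hd : ∀ t : ℝ, HasDerivAt (fun t : ℝ => t ^ (2 * m + 1) * Real.exp (-t ^ 2))
        ((2 * m + 1) * (t ^ (2 * m) * Real.exp (-t ^ 2)) -
          2 * (t ^ (2 * (m + 1)) * Real.exp (-t ^ 2))) t := by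
      intro t
      have h := (hasDerivAt_pow (2 * m + 1) t).mul ((hasDerivAt_pow 2 t).neg.exp)
      refine h.congr_deriv ?_
      simp only [Pi.neg_apply, Nat.add_sub_cancel]
      push_cast
      ring
    have h1 := (integrable_pow_mul_exp_neg_sq (2 * m)).const_mul (2 * (m : ℝ) + 1)
    have h2 := (integrable_pow_mul_exp_neg_sq (2 * (m + 1))).const_mul 2
    have h := integral_eq_zero_of_hasDerivAt_of_integrable hd (h1.sub h2)
      (integrable_pow_mul_exp_neg_sq _)
    rw [integral_sub h1 h2, integral_const_mul, integral_const_mul, ih] at h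
    rw [gaussMoment]
    linarith

/-! ### Numerical bound for the constant 0.89 -/

/-- The terms of the series for `π` times the squared distance covariance of a standard normal
variable with itself. -/
noncomputable def dCovTerm (m : ℕ) : ℝ := coshGapCoeff m * gaussMoment m ^ 2

lemma dCovTerm_nonneg (m : ℕ) : 0 ≤ dCovTerm m :=
  mul_nonneg (coshGapCoeff_nonneg m) (sq_nonneg _)

/-- The full sum is `4(1 + π/3 - √3) ≈ 1.2606`, against `1/0.89² ≈ 1.2625`. Six terms are computed
exactly; the rest is dominated by `A`, which decays like `m^(-5/2)`. -/
lemma sum_dCovTerm_le (n : ℕ) : ∑ m ∈ Finset.range n, dCovTerm m ≤ 1 / 0.89 ^ 2 := by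
  set A : ℕ → ℝ := fun m => 4 ^ (m + 1) / (2 * (m + 1)).factorial * gaussMoment m ^ 2 with hA
  have hA0 : ∀ m, 0 ≤ A m := fun m => by positivity
  have hle : ∀ m, dCovTerm m ≤ A m := fun m => by
    unfold dCovTerm coshGapCoeff
    rw [hA]
    exact mul_le_mul_of_nonneg_right
      (div_le_div_of_nonneg_right (by linarith) (Nat.cast_nonneg _)) (sq_nonneg _)
  have hrec : ∀ m : ℕ, A (m + 1) * ((2 * m + 3) * (2 * m + 4)) = A m * (2 * m + 1) ^ 2 := by
    intro m
    simp only [hA, gaussMoment]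
    have hf : ((2 * (m + 1 + 1)).factorial : ℝ) =
        (2 * m + 4) * ((2 * m + 3) * (2 * (m + 1)).factorial) := by
      rw [show 2 * (m + 1 + 1) = 2 * (m + 1) + 1 + 1 by ring, Nat.factorial_succ,
        Nat.factorial_succ]
      push_cast
      ring
    rw [hf]
    field_simp
    ring
  -- Telescoping tail bound `A N * (2N/3 + 1)`: with these constants the cubic and quadratic terms
  -- of `h2` cancel, leaving `5 ≤ 2N`.
  have key : ∀ k : ℕ, ∑ m ∈ Finset.range (6 + k), dCovTerm m +
      A (6 + k) * (2 / 3 * ((6 + k : ℕ) : ℝ) + 1) ≤ 1 / 0.89 ^ 2 := by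
    intro k
    induction k with
    | zero =>
      simp only [Finset.sum_range_succ, Finset.sum_range_zero, dCovTerm, coshGapCoeff, hA,
        gaussMoment, Nat.factorial]
      norm_num
    | succ k ih =>
      refine le_trans ?_ ih
      rw [← add_assoc, Finset.sum_range_succ]
      generalize hN : 6 + k = N
      have hN6 : (6 : ℝ) ≤ N := by rw [← hN]; push_cast; linarith [(Nat.cast_nonneg k : (0:ℝ) ≤ k)]
      have h1 : A (N + 1) = A N * ((2 * N + 1) ^ 2 / ((2 * N + 3) * (2 * N + 4))) := by
        rw [← mul_div_assoc, eq_div_iff (by positivity)]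
        exact hrec N
      have h2 : 1 + (2 * (N : ℝ) + 1) ^ 2 / ((2 * N + 3) * (2 * N + 4)) * (2 / 3 * (N + 1) + 1) ≤
          2 / 3 * N + 1 := by
        rw [div_mul_eq_mul_div, ← le_sub_iff_add_le', div_le_iff₀ (by positivity)]
        nlinarith
      have h3 := mul_le_mul_of_nonneg_left h2 (hA0 N)
      have h4 := hle N
      rw [h1]
      push_cast
      nlinarith
  have h0 := key n
  have h1 : ∑ m ∈ Finset.range n, dCovTerm m ≤ ∑ m ∈ Finset.range (6 + n), dCovTerm m :=
    Finset.sum_le_sum_of_subset_of_nonneg (Finset.range_mono (by omega)) fun m _ _ => dCovTerm_nonneg m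
  have h2 : 0 ≤ A (6 + n) * (2 / 3 * ((6 + n : ℕ) : ℝ) + 1) := mul_nonneg (hA0 _) (by positivity)
  linarith

/-! ### The Gaussian integrand and its symmetrization -/

/-- The integrand of the squared distance covariance of a standard normal pair of correlation
`r`. -/
noncomputable def gaussIntegrand (r : ℝ) (z : ℝ × ℝ) : ℝ :=
  Real.exp (-z.1 ^ 2) * Real.exp (-z.2 ^ 2) * (Real.exp (-(r * (z.1 * z.2))) - 1) ^ 2 /
    (Real.pi * Real.pi * |z.1| ^ 2 * |z.2| ^ 2)

/-- The even part of `gaussIntegrand` in the correlation. -/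
noncomputable def gaussIntegrandSymm (r : ℝ) (z : ℝ × ℝ) : ℝ :=
  Real.exp (-z.1 ^ 2) * Real.exp (-z.2 ^ 2) * coshGap (r * (z.1 * z.2)) /
    (Real.pi * Real.pi * |z.1| ^ 2 * |z.2| ^ 2)

@[fun_prop]
lemma measurable_coshGap : Measurable coshGap := by
  unfold coshGap
  fun_prop

lemma measurable_gaussIntegrand (r : ℝ) : Measurable (gaussIntegrand r) := by
  unfold gaussIntegrand
  fun_prop

lemma measurable_gaussIntegrandSymm (r : ℝ) : Measurable (gaussIntegrandSymm r) := by
  unfold gaussIntegrandSymm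
  fun_prop

lemma gaussIntegrand_nonneg (r : ℝ) (z : ℝ × ℝ) : 0 ≤ gaussIntegrand r z := by
  unfold gaussIntegrand
  positivity

lemma gaussIntegrandSymm_nonneg (r : ℝ) (z : ℝ × ℝ) : 0 ≤ gaussIntegrandSymm r z := by
  unfold gaussIntegrandSymm
  have := coshGap_nonneg (r * (z.1 * z.2))
  positivity

lemma gaussIntegrand_add_neg (r : ℝ) (z : ℝ × ℝ) :
    gaussIntegrand r z + gaussIntegrand (-r) z = 2 * gaussIntegrandSymm r z := by
  have h : ∀ u : ℝ, (Real.exp (-u) - 1) ^ 2 + (Real.exp u - 1) ^ 2 = 2 * coshGap u := by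
    intro u
    rw [coshGap, Real.cosh_eq, Real.cosh_eq, show 2 * u = u + u by ring, Real.exp_add, neg_add,
      Real.exp_add]
    ring
  have h' := h (r * (z.1 * z.2))
  unfold gaussIntegrand gaussIntegrandSymm
  rw [neg_mul, neg_neg, ← add_div, ← mul_add, h']
  ring

lemma gaussIntegrandSymm_le {r : ℝ} (hr : |r| ≤ 1) (z : ℝ × ℝ) :
    gaussIntegrandSymm r z ≤ r ^ 2 * gaussIntegrandSymm 1 z := by
  unfold gaussIntegrandSymm
  rw [one_mul, ← mul_div_assoc, mul_left_comm (r ^ 2)]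
  exact div_le_div_of_nonneg_right
    (mul_le_mul_of_nonneg_left (coshGap_mul_le hr _) (by positivity)) (by positivity)

/-- On the axes division by zero makes the integrands 0, so the series expansion and the lower bound
can fail there. -/
lemma ae_fst_snd_ne_zero : ∀ᵐ z : ℝ × ℝ, z.1 ≠ 0 ∧ z.2 ≠ 0 := by
  have h1 : ∀ᵐ z : ℝ × ℝ, z.1 ≠ 0 :=
    (Measure.quasiMeasurePreserving_fst (μ := (volume : Measure ℝ))
      (ν := (volume : Measure ℝ))).ae (Measure.ae_ne volume 0)
  have h2 : ∀ᵐ z : ℝ × ℝ, z.2 ≠ 0 :=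
    (Measure.quasiMeasurePreserving_snd (μ := (volume : Measure ℝ))
      (ν := (volume : Measure ℝ))).ae (Measure.ae_ne volume 0)
  exact h1.and h2

lemma integrable_prod_pow_mul_exp (m : ℕ) :
    Integrable fun z : ℝ × ℝ => z.1 ^ (2 * m) * Real.exp (-z.1 ^ 2) *
      (z.2 ^ (2 * m) * Real.exp (-z.2 ^ 2)) :=
  (integrable_pow_mul_exp_neg_sq (2 * m)).mul_prod (integrable_pow_mul_exp_neg_sq (2 * m))

lemma integral_prod_pow_mul_exp (m : ℕ) :
    ∫ z : ℝ × ℝ, z.1 ^ (2 * m) * Real.exp (-z.1 ^ 2) * (z.2 ^ (2 * m) * Real.exp (-z.2 ^ 2)) =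
      Real.pi * gaussMoment m ^ 2 := by
  have h := integral_prod_mul (μ := (volume : Measure ℝ)) (ν := (volume : Measure ℝ))
    (fun t : ℝ => t ^ (2 * m) * Real.exp (-t ^ 2)) (fun t : ℝ => t ^ (2 * m) * Real.exp (-t ^ 2))
  rw [integral_pow_mul_exp_neg_sq] at h
  refine h.trans ?_
  linear_combination gaussMoment m ^ 2 * Real.mul_self_sqrt Real.pi_pos.le

lemma sq_mul_le_gaussIntegrandSymm {r : ℝ} {z : ℝ × ℝ} (hz : z.1 ≠ 0 ∧ z.2 ≠ 0) :
    r ^ 2 / Real.pi ^ 2 * (z.1 ^ (2 * 0) * Real.exp (-z.1 ^ 2) *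
      (z.2 ^ (2 * 0) * Real.exp (-z.2 ^ 2))) ≤ gaussIntegrandSymm r z := by
  obtain ⟨h1, h2⟩ := hz
  unfold gaussIntegrandSymm
  rw [sq_abs, sq_abs, le_div_iff₀ (by positivity)]
  calc _ = Real.exp (-z.1 ^ 2) * Real.exp (-z.2 ^ 2) * (r * (z.1 * z.2)) ^ 2 := by
        have := Real.pi_pos
        field_simp
        ring
    _ ≤ _ := by
        gcongr
        exact sq_le_coshGap _

/-- Tonelli allows termwise integration of the nonnegative series. Working with `∫⁻` also makes the
bound yield integrability. -/
lemma lintegral_gaussIntegrandSymm_one_le :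
    ∫⁻ z, ENNReal.ofReal (gaussIntegrandSymm 1 z) ≤ ENNReal.ofReal (1 / 0.89 ^ 2 / Real.pi) := by
  set f : ℕ → ℝ × ℝ → ℝ := fun m z => coshGapCoeff m / Real.pi ^ 2 *
    (z.1 ^ (2 * m) * Real.exp (-z.1 ^ 2) * (z.2 ^ (2 * m) * Real.exp (-z.2 ^ 2))) with hf
  have hf0 : ∀ m z, 0 ≤ f m z := fun m z => by
    have := coshGapCoeff_nonneg m
    have h1 := (even_two_mul m).pow_nonneg z.1
    have h2 := (even_two_mul m).pow_nonneg z.2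
    positivity
  have hfi : ∀ m, Integrable (f m) := fun m => (integrable_prod_pow_mul_exp m).const_mul _
  have hsum : ∀ᵐ z : ℝ × ℝ, ENNReal.ofReal (gaussIntegrandSymm 1 z) =
      ∑' m, ENNReal.ofReal (f m z) := by
    filter_upwards [ae_fst_snd_ne_zero] with z hz
    obtain ⟨h1, h2⟩ := hz
    have h := ((hasSum_coshGap (1 * (z.1 * z.2))).mul_left
      (Real.exp (-z.1 ^ 2) * Real.exp (-z.2 ^ 2))).div_const
      (Real.pi * Real.pi * |z.1| ^ 2 * |z.2| ^ 2)
    have h' : HasSum (fun m => f m z) (gaussIntegrandSymm 1 z) := by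
      refine h.congr_fun fun m => ?_
      have := Real.pi_pos
      simp only [hf, sq_abs, one_mul]
      field_simp
      ring
    rw [← ENNReal.ofReal_tsum_of_nonneg (hf0 · z) h'.summable, h'.tsum_eq]
  rw [lintegral_congr_ae hsum,
    lintegral_tsum fun m => (hfi m).aestronglyMeasurable.aemeasurable.ennreal_ofReal]
  refine ENNReal.tsum_le_of_sum_range_le fun n => ?_
  have hterm : ∀ m, ∫⁻ z, ENNReal.ofReal (f m z) = ENNReal.ofReal (dCovTerm m / Real.pi) := by
    intro m
    rw [← ofReal_integral_eq_lintegral_ofReal (hfi m) (ae_of_all _ (hf0 m)), hf,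
      integral_const_mul, integral_prod_pow_mul_exp, dCovTerm]
    congr 1
    have := Real.pi_pos
    field_simp
  simp_rw [hterm]
  rw [← ENNReal.ofReal_sum_of_nonneg fun m _ => div_nonneg (dCovTerm_nonneg m) Real.pi_pos.le,
    ← Finset.sum_div]
  exact ENNReal.ofReal_le_ofReal (div_le_div_of_nonneg_right (sum_dCovTerm_le n) Real.pi_pos.le)

lemma integrable_gaussIntegrandSymm_one : Integrable (gaussIntegrandSymm 1) :=
  (lintegral_ofReal_ne_top_iff_integrable
    (measurable_gaussIntegrandSymm 1).aestronglyMeasurable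
    (ae_of_all _ (gaussIntegrandSymm_nonneg 1))).1
    (ne_top_of_le_ne_top ENNReal.ofReal_ne_top lintegral_gaussIntegrandSymm_one_le)

lemma integrable_gaussIntegrandSymm {r : ℝ} (hr : |r| ≤ 1) :
    Integrable (gaussIntegrandSymm r) :=
  (integrable_gaussIntegrandSymm_one.const_mul (r ^ 2)).mono'
    (measurable_gaussIntegrandSymm r).aestronglyMeasurable
    (ae_of_all _ fun z => by
      rw [Real.norm_of_nonneg (gaussIntegrandSymm_nonneg r z)]
      exact gaussIntegrandSymm_le hr z)

lemma integrable_gaussIntegrand {r : ℝ} (hr : |r| ≤ 1) : Integrable (gaussIntegrand r) :=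
  ((integrable_gaussIntegrandSymm hr).const_mul 2).mono'
    (measurable_gaussIntegrand r).aestronglyMeasurable
    (ae_of_all _ fun z => by
      rw [Real.norm_of_nonneg (gaussIntegrand_nonneg r z), ← gaussIntegrand_add_neg]
      exact le_add_of_nonneg_right (gaussIntegrand_nonneg (-r) z))

/-- Reflecting the first frequency changes the sign of `r` and preserves Lebesgue measure. -/
lemma integral_gaussIntegrand_neg (r : ℝ) :
    ∫ z, gaussIntegrand (-r) z = ∫ z, gaussIntegrand r z := by
  have hmp : MeasurePreserving (Prod.map (fun t : ℝ => -t) id : ℝ × ℝ → ℝ × ℝ) volume volume :=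
    (Measure.measurePreserving_neg (volume : Measure ℝ)).prod (MeasurePreserving.id _)
  have he : MeasurableEmbedding (Prod.map (fun t : ℝ => -t) id : ℝ × ℝ → ℝ × ℝ) :=
    ((Homeomorph.neg ℝ).prodCongr (Homeomorph.refl ℝ)).measurableEmbedding
  rw [← hmp.integral_comp he]
  congr 1
  funext z
  simp [gaussIntegrand]

lemma integral_gaussIntegrand {r : ℝ} (hr : |r| ≤ 1) :
    ∫ z, gaussIntegrand r z = ∫ z, gaussIntegrandSymm r z := by
  have h : ∫ z, (gaussIntegrand r z + gaussIntegrand (-r) z) = ∫ z, 2 * gaussIntegrandSymm r z :=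
    integral_congr_ae (ae_of_all _ (gaussIntegrand_add_neg r))
  rw [integral_add (integrable_gaussIntegrand hr)
    (integrable_gaussIntegrand (by rwa [abs_neg])), integral_gaussIntegrand_neg,
    integral_const_mul] at h
  linarith

/-! ### Quadratic bounds in the correlation -/

/-- The squared distance covariance of a standard normal pair of correlation `r`. -/
noncomputable def gaussDCovSq (r : ℝ) : ℝ := ∫ z, gaussIntegrand r z

lemma gaussDCovSq_zero : gaussDCovSq 0 = 0 := by
  simp [gaussDCovSq, gaussIntegrand]

lemma gaussDCovSq_le {r : ℝ} (hr : |r| ≤ 1) : gaussDCovSq r ≤ r ^ 2 * gaussDCovSq 1 := by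
  rw [gaussDCovSq, gaussDCovSq, integral_gaussIntegrand hr, integral_gaussIntegrand (by simp),
    ← integral_const_mul]
  exact integral_mono (integrable_gaussIntegrandSymm hr)
    (integrable_gaussIntegrandSymm_one.const_mul _) (gaussIntegrandSymm_le hr)

lemma sq_div_pi_le_gaussDCovSq {r : ℝ} (hr : |r| ≤ 1) : r ^ 2 / Real.pi ≤ gaussDCovSq r := by
  have h : ∫ z : ℝ × ℝ, r ^ 2 / Real.pi ^ 2 * (z.1 ^ (2 * 0) * Real.exp (-z.1 ^ 2) *
      (z.2 ^ (2 * 0) * Real.exp (-z.2 ^ 2))) ≤ ∫ z, gaussIntegrandSymm r z :=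
    integral_mono_ae ((integrable_prod_pow_mul_exp 0).const_mul _)
      (integrable_gaussIntegrandSymm hr)
      (ae_fst_snd_ne_zero.mono fun z hz => sq_mul_le_gaussIntegrandSymm hz)
  rw [integral_const_mul, integral_prod_pow_mul_exp] at h
  rw [gaussDCovSq, integral_gaussIntegrand hr]
  refine le_trans (le_of_eq ?_) h
  have := Real.pi_pos
  simp only [gaussMoment]
  field_simp

lemma gaussDCovSq_one_pos : 0 < gaussDCovSq 1 :=
  lt_of_lt_of_le (by positivity) (sq_div_pi_le_gaussDCovSq (r := 1) (by simp))

lemma gaussDCovSq_one_le : gaussDCovSq 1 ≤ 1 / 0.89 ^ 2 / Real.pi := by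
  rw [gaussDCovSq, integral_gaussIntegrand (by simp)]
  have h := lintegral_gaussIntegrandSymm_one_le
  rw [← ofReal_integral_eq_lintegral_ofReal integrable_gaussIntegrandSymm_one
    (ae_of_all _ (gaussIntegrandSymm_nonneg 1))] at h
  exact (ENNReal.ofReal_le_ofReal_iff (by positivity)).1 h

lemma le_gaussDCovSq {r : ℝ} (hr : |r| ≤ 1) :
    0.89 ^ 2 * (r ^ 2 * gaussDCovSq 1) ≤ gaussDCovSq r := by
  refine le_trans ?_ (sq_div_pi_le_gaussDCovSq hr)
  calc (0.89 : ℝ) ^ 2 * (r ^ 2 * gaussDCovSq 1)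
      ≤ 0.89 ^ 2 * (r ^ 2 * (1 / 0.89 ^ 2 / Real.pi)) := by
        gcongr
        exact gaussDCovSq_one_le
    _ = r ^ 2 / Real.pi := by ring

/-! ### From Gaussian pairs to the correlation -/

section GaussianPair

variable {Ω : Type*} [MeasurableSpace Ω] {P : Measure Ω} {x y : Ω → ℝ}

lemma variance_linear_comb [IsProbabilityMeasure P] (hx : MemLp x 2 P) (hy : MemLp y 2 P)
    (a b : ℝ) : Var[fun ω => a * x ω + b * y ω; P] =
      a ^ 2 * Var[x; P] + 2 * a * b * cov[x, y; P] + b ^ 2 * Var[y; P] := by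
  rw [variance_fun_add (hx.const_mul a) (hy.const_mul b), variance_const_mul, variance_const_mul,
    covariance_const_mul_left, covariance_const_mul_right]
  ring

lemma abs_covariance_le_one [IsProbabilityMeasure P] (hx : MemLp x 2 P) (hy : MemLp y 2 P)
    (vx : Var[x; P] = 1) (vy : Var[y; P] = 1) : |cov[x, y; P]| ≤ 1 := by
  have h1 := variance_nonneg (fun ω => 1 * x ω + 1 * y ω) P
  have h2 := variance_nonneg (fun ω => 1 * x ω + (-1) * y ω) P
  rw [variance_linear_comb hx hy, vx, vy] at h1 h2
  rw [abs_le]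
  constructor <;> linarith

/-- The joint characteristic function is the product of the marginals times `e^{-rts}`; factoring
the marginals out leaves `gaussIntegrand`. -/
lemma dCovSq_of_gaussian [IsProbabilityMeasure P]
    (h : HasGaussianLaw (fun ω => (x ω, y ω)) P) (mx : ∫ ω, x ω ∂P = 0) (my : ∫ ω, y ω ∂P = 0)
    (vx : Var[x; P] = 1) (vy : Var[y; P] = 1) :
    dCovSq P x y = gaussDCovSq cov[x, y; P] := by
  have hx := h.fst
  have hy := h.snd
  have cx : ∀ t : ℝ, charFun (P.map x) t = ((Real.exp (-t ^ 2 / 2) : ℝ) : ℂ) := by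
    intro t
    rw [hx.map_eq_gaussianReal, charFun_gaussianReal, mx, vx]
    push_cast
    congr 1
    simp
    ring
  have cy : ∀ t : ℝ, charFun (P.map y) t = ((Real.exp (-t ^ 2 / 2) : ℝ) : ℂ) := by
    intro t
    rw [hy.map_eq_gaussianReal, charFun_gaussianReal, my, vy]
    push_cast
    congr 1
    simp
    ring
  have cxy : ∀ t s : ℝ, charFun (P.map fun ω => WithLp.toLp 2 (x ω, y ω)) (WithLp.toLp 2 (t, s)) =
      ((Real.exp (-(t ^ 2 + 2 * t * s * cov[x, y; P] + s ^ 2) / 2) : ℝ) : ℂ) := by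
    intro t s
    rw [(h.toLp_prodMk 2).charFun_map_eq]
    have hin : (fun ω => inner ℝ (WithLp.toLp 2 (t, s)) (WithLp.toLp 2 (x ω, y ω))) =
        fun ω => t * x ω + s * y ω := by
      funext ω
      simp [WithLp.prod_inner_apply, mul_comm]
    rw [hin, variance_linear_comb hx.memLp_two hy.memLp_two, vx, vy,
      integral_add (hx.integrable.const_mul t) (hy.integrable.const_mul s), integral_const_mul,
      integral_const_mul, mx, my]
    push_cast
    congr 1
    simp
    ring
  unfold dCovSq gaussDCovSq
  congr 1
  funext z
  unfold gaussIntegrand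
  congr 1
  rw [cx, cy, cxy, ← Complex.ofReal_mul, ← Complex.ofReal_sub, Complex.norm_real, Real.norm_eq_abs,
    sq_abs]
  have e1 : Real.exp (-(z.1 ^ 2 + 2 * z.1 * z.2 * cov[x, y; P] + z.2 ^ 2) / 2) =
      Real.exp (-z.1 ^ 2 / 2) * Real.exp (-z.2 ^ 2 / 2) *
        Real.exp (-(cov[x, y; P] * (z.1 * z.2))) := by
    rw [← Real.exp_add, ← Real.exp_add]
    ring_nf
  have e2 : ∀ t : ℝ, Real.exp (-t ^ 2) = Real.exp (-t ^ 2 / 2) ^ 2 := by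
    intro t
    rw [← Real.exp_nat_mul]
    ring_nf
  rw [e1, e2, e2]
  ring

end GaussianPair

/-! ### Aggregation over coordinates -/

lemma sum_sum_cov_sq_self {Ω : Type*} [MeasurableSpace Ω] {P : Measure Ω} {p : ℕ}
    {X : Ω → EuclideanSpace ℝ (Fin p)}
    (cov_X : ∀ i i', cov[fun ω => X ω i, fun ω => X ω i'; P] =
      (1 : Matrix (Fin p) (Fin p) ℝ) i i') :
    ∑ i, ∑ i', cov[fun ω => X ω i, fun ω => X ω i'; P] ^ 2 = p := by
  simp [cov_X, Matrix.one_apply]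

section StdGaussianPair

variable {Ω : Type*} [MeasurableSpace Ω] {P : Measure Ω} [IsProbabilityMeasure P] {p q : ℕ}
  {X : Ω → EuclideanSpace ℝ (Fin p)} {Y : Ω → EuclideanSpace ℝ (Fin q)}
  {S : Matrix (Fin p) (Fin q) ℝ}

lemma sum_sum_dCovSq_self
    (hX : HasGaussianLaw X P) (mean_X : ∀ i, ∫ ω, X ω i ∂P = 0)
    (cov_X : ∀ i i', cov[fun ω => X ω i, fun ω => X ω i'; P] =
      (1 : Matrix (Fin p) (Fin p) ℝ) i i') :
    ∑ i, ∑ i', dCovSq P (fun ω => X ω i) (fun ω => X ω i') = p * gaussDCovSq 1 := by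
  -- The case `i = i'` is included: the pair is then a degenerate Gaussian with correlation 1.
  have hG : ∀ i i', HasGaussianLaw (fun ω => (X ω i, X ω i')) P := fun i i' =>
    hX.map_fun ((EuclideanSpace.proj i : EuclideanSpace ℝ (Fin p) →L[ℝ] ℝ).prod
      (EuclideanSpace.proj i'))
  have hv : ∀ i, Var[fun ω => X ω i; P] = 1 := fun i => by
    rw [← covariance_self (hG i i).fst.aemeasurable, cov_X, Matrix.one_apply_eq]
  have hd : ∀ i i', dCovSq P (fun ω => X ω i) (fun ω => X ω i') =
      if i = i' then gaussDCovSq 1 else 0 := fun i i' => by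
    rw [dCovSq_of_gaussian (hG i i') (mean_X i) (mean_X i') (hv i) (hv i'), cov_X,
      Matrix.one_apply]
    split_ifs
    · rfl
    · exact gaussDCovSq_zero
  simp [hd]

lemma IsStdGaussianPair.signal_bounds (h : IsStdGaussianPair P X Y S) :
    (0.89 : ℝ) ^ 2 * signalCov P X Y ≤ signalDCov P X Y ∧
      signalDCov P X Y ≤ signalCov P X Y := by
  have hG : ∀ i j, HasGaussianLaw (fun ω => (X ω i, Y ω j)) P := fun i j =>
    h.gaussian.map_fun
      ((EuclideanSpace.proj i : EuclideanSpace ℝ (Fin p) →L[ℝ] ℝ).prodMap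
        (EuclideanSpace.proj j : EuclideanSpace ℝ (Fin q) →L[ℝ] ℝ))
  have hvX : ∀ i j, Var[fun ω => X ω i; P] = 1 ∧ Var[fun ω => Y ω j; P] = 1 := fun i j => by
    rw [← covariance_self (hG i j).fst.aemeasurable, h.cov_X, Matrix.one_apply_eq,
      ← covariance_self (hG i j).snd.aemeasurable, h.cov_Y, Matrix.one_apply_eq]
    exact ⟨rfl, rfl⟩
  have hd : ∀ i j, dCovSq P (fun ω => X ω i) (fun ω => Y ω j) = gaussDCovSq (S i j) :=
    fun i j => by
      rw [dCovSq_of_gaussian (hG i j) (h.mean_X i) (h.mean_Y j) (hvX i j).1 (hvX i j).2, h.cov_XY]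
  have hS : ∀ i j, |S i j| ≤ 1 := fun i j => by
    rw [← h.cov_XY]
    exact abs_covariance_le_one (hG i j).fst.memLp_two (hG i j).snd.memLp_two
      (hvX i j).1 (hvX i j).2
  have hg := gaussDCovSq_one_pos
  have hC : signalCov P X Y = (∑ i, ∑ j, S i j ^ 2) / √((p : ℝ) * q) := by
    unfold signalCov
    rw [sum_sum_cov_sq_self h.cov_X, sum_sum_cov_sq_self h.cov_Y]
    simp [h.cov_XY]
  have hD : signalDCov P X Y =
      (∑ i, ∑ j, gaussDCovSq (S i j)) / gaussDCovSq 1 / √((p : ℝ) * q) := by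
    unfold signalDCov
    rw [sum_sum_dCovSq_self h.gaussian.fst h.mean_X h.cov_X,
      sum_sum_dCovSq_self h.gaussian.snd h.mean_Y h.cov_Y,
      show (p : ℝ) * gaussDCovSq 1 * (q * gaussDCovSq 1) = gaussDCovSq 1 ^ 2 * (p * q) by ring,
      Real.sqrt_mul (sq_nonneg _), Real.sqrt_sq hg.le, div_div]
    simp [hd]
  rw [hC, hD, ← mul_div_assoc]
  constructor
  · refine div_le_div_of_nonneg_right ?_ (Real.sqrt_nonneg _)
    rw [le_div_iff₀ hg, mul_assoc]
    simp_rw [Finset.sum_mul, Finset.mul_sum]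
    exact Finset.sum_le_sum fun i _ => Finset.sum_le_sum fun j _ => le_gaussDCovSq (hS i j)
  · refine div_le_div_of_nonneg_right ?_ (Real.sqrt_nonneg _)
    rw [div_le_iff₀ hg]
    simp_rw [Finset.sum_mul]
    exact Finset.sum_le_sum fun i _ => Finset.sum_le_sum fun j _ => gaussDCovSq_le (hS i j)

end StdGaussianPair

theorem proposition5 {ι : Type*} {Ω : ι → Type*} [∀ k, MeasurableSpace (Ω k)]
    (P : ∀ k, Measure (Ω k)) [∀ k, IsProbabilityMeasure (P k)]
    (p q : ι → ℕ) (hp : ∀ k, 0 < p k) (hq : ∀ k, 0 < q k)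
    (X : ∀ k, Ω k → EuclideanSpace ℝ (Fin (p k)))
    (Y : ∀ k, Ω k → EuclideanSpace ℝ (Fin (q k)))
    (S : ∀ k, Matrix (Fin (p k)) (Fin (q k)) ℝ)
    (hXY : ∀ k, IsStdGaussianPair (P k) (X k) (Y k) (S k)) :
    -- the inequality in every fixed pair of dimensions
    (∀ k, (0.89 : ℝ) ^ 2 * signalCov (P k) (X k) (Y k) ≤ signalDCov (P k) (X k) (Y k) ∧
      signalDCov (P k) (X k) (Y k) ≤ signalCov (P k) (X k) (Y k)) ∧
    -- the inequality for the limits, in any regime in which both dimensions tend to infinity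
    (∀ (l : Filter ι) [l.NeBot], Tendsto p l atTop → Tendsto q l atTop →
      ∀ φ₁ φ₂ : ℝ,
        Tendsto (fun k => signalDCov (P k) (X k) (Y k)) l (𝓝 φ₁) →
        Tendsto (fun k => signalCov (P k) (X k) (Y k)) l (𝓝 φ₂) →
        (0.89 : ℝ) ^ 2 * φ₂ ≤ φ₁ ∧ φ₁ ≤ φ₂) := by
  have hb := fun k => (hXY k).signal_bounds
  refine ⟨hb, fun l _ _ _ φ₁ φ₂ h₁ h₂ => ⟨?_, ?_⟩⟩
  · exact le_of_tendsto_of_tendsto' (h₂.const_mul _) h₁ fun k => (hb k).1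
  · exact le_of_tendsto_of_tendsto' h₁ h₂ fun k => (hb k).2
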